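/- Let $K$ be a field, let $G$ be a finite simple graph on the vertex set $V=\{x_1,\dots,x_n\}$, and let $S=K[x_1,\dots,x_n]$. Suppose that $G$ is * a Cameron–Walker graph, i.e. $G$ is connected, the largest number of edges of an induced matching of $G$ (a matching that is an induced subgraph of $G$) equals the largest number of edges of a matching of $G$, and $G$ is neither a star (a graph in which one vertex is adjacent to all other vertices and there are no further edges; a single vertex counts as a star) nor a star triangle (a union of triangles that share exactly one common vertex); and * Cohen–Macaulay over $K$, i.e. $S/(x_ix_j : \{x_i,x_j\}\in E(G))$ is a Cohen–Macaulay ring. Let $I_G\subset S$ be the vertex cover ideal of $G$, generated by the monomials $u_C=\prod_{x_i\in C}x_i$, where $C$ ranges over the minimal vertex covers of $G$. Then every power $I_G^k$, $k\ge 0$, has a linear resolution: for some $d$ (depending on $k$) the minimal graded free resolution of $I_G^k$ over $S$ has the form $$\cdots\to S(-d-2)^{b_2}\to S(-d-1)^{b_1}\to S(-d)^{b_0}\to I_G^k\to 0 .$$ -/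

import Mathlib

/-!
Let `A` be the edge ring. Every minimal vertex cover `C` gives a minimal, hence associated, prime
of `A`, and depth is at most the dimension of the quotient by any associated prime. If `A` is
Cohen–Macaulay this forces `|C|` to be the smallest size of a vertex cover: `G` is unmixed.

Now let `M` be a maximum matching which is induced. No augmenting path exists, and in an unmixed
graph an independent set `B` with `N[B] ⊆ N[A]`, `A` independent, has at most `|A|` elements. These
two facts show that each vertex lies in the closed neighbourhood of a simplicial vertex, and that
two such closed neighbourhoods are equal or disjoint. So `V` is partitioned into the sets `N[s]`
with `s` simplicial; let `r` send a vertex to the chosen `s` of its block.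

A minimal vertex cover misses exactly one vertex of each block. Consequently all generators of the
`k`-th power of the cover ideal have the same degree in each block, and in a generator a factor
`x_{r v}` can be exchanged for `x_v` as long as the exponent of `x_v` is below `k`, because it is
always possible to let a cover miss `r v` in place of `v`. The power therefore has linear quotients
when its generators are ordered by their total exponent outside the simplicial vertices `r v`, and
the linear resolution is built up from Koszul complexes of sets of variables by mapping cones.
-/

namespace CoverIdeal

section Graphs

variable {V : Type*}

/-- The matching number `m(G)`: the largest number of edges of a matching of `G`. -/
noncomputable def matchingNumber (G : SimpleGraph V) : ℕ :=
  sSup {n | ∃ M : G.Subgraph, M.IsMatching ∧ M.edgeSet.ncard = n}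

/-- The induced matching number `im(G)`: the largest number of edges of a matching of `G`
that is an induced subgraph of `G`. -/
noncomputable def inducedMatchingNumber (G : SimpleGraph V) : ℕ :=
  sSup {n | ∃ M : G.Subgraph, M.IsMatching ∧ M.IsInduced ∧ M.edgeSet.ncard = n}

/-- A star: some centre `c` is joined to all other vertices, and there are no further edges. -/
def IsStar (G : SimpleGraph V) : Prop :=
  ∃ c : V, ∀ v w : V, G.Adj v w ↔ v ≠ w ∧ (v = c ∨ w = c)

/-- A star triangle: triangles that share one common vertex `c` and are otherwise disjoint.
Each vertex other than `c` is adjacent to `c` and to exactly one further vertex. -/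
def IsStarTriangle (G : SimpleGraph V) : Prop :=
  ∃ c : V, ∀ v : V, v ≠ c → G.Adj v c ∧ ∃! w : V, w ≠ c ∧ G.Adj v w

/-- Cameron–Walker graphs: connected graphs with `im(G) = m(G)`, other than stars and
star triangles. -/
structure IsCameronWalker (G : SimpleGraph V) : Prop where
  connected : G.Connected
  inducedMatchingNumber_eq : inducedMatchingNumber G = matchingNumber G
  not_isStar : ¬ IsStar G
  not_isStarTriangle : ¬ IsStarTriangle G

end Graphs

section CohenMacaulay

/-- The depth of a local ring: the supremum of the lengths of the regular sequences
in its maximal ideal. -/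
noncomputable def localDepth (R : Type*) [CommRing R] [IsLocalRing R] : ℕ∞ :=
  ⨆ rs ∈ {rs : List R | RingTheory.Sequence.IsRegular R rs ∧
    ∀ r ∈ rs, r ∈ IsLocalRing.maximalIdeal R}, (rs.length : ℕ∞)

/-- A Cohen–Macaulay ring: a Noetherian ring whose localizations at maximal ideals have
depth equal to their Krull dimension. -/
structure IsCohenMacaulayRing (R : Type*) [CommRing R] : Prop where
  noetherian : IsNoetherianRing R
  depth_eq_dim : ∀ (p : Ideal R) [p.IsMaximal],
    (localDepth (Localization.AtPrime p) : WithBot ℕ∞) = ringKrullDim (Localization.AtPrime p)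

end CohenMacaulay

section Ideals

variable (K : Type*) [Field K] {V : Type*}

/-- The edge ideal of `G`, generated by the products `x_v x_w` with `{v, w}` an edge. -/
noncomputable def edgeIdeal (G : SimpleGraph V) : Ideal (MvPolynomial V K) :=
  Ideal.span {f | ∃ v w : V, G.Adj v w ∧ f = MvPolynomial.X v * MvPolynomial.X w}

/-- `G` is Cohen–Macaulay over `K` if the quotient of the polynomial ring by the edge ideal
is a Cohen–Macaulay ring. -/
def IsCohenMacaulayGraph (G : SimpleGraph V) : Prop :=
  IsCohenMacaulayRing (MvPolynomial V K ⧸ edgeIdeal K G)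

/-- The (vertex) cover ideal of `G`, generated by the monomials `∏_{v ∈ C} x_v`,
`C` a minimal vertex cover of `G`. -/
noncomputable def coverIdeal (G : SimpleGraph V) : Ideal (MvPolynomial V K) :=
  Ideal.span {f | ∃ C : Finset V, Minimal (fun D : Finset V => G.IsVertexCover (D : Set V)) C ∧
    f = ∏ v ∈ C, MvPolynomial.X v}

variable {K}

/-- `I` has a linear resolution: for some `d` there is an exact sequence
`⋯ → S(-d-2)^{b 2} → S(-d-1)^{b 1} → S(-d)^{b 0} → I → 0` of graded modules over the polynomial
ring `S`. A degree-preserving map `S(-d-i-1)^{b (i+1)} → S(-d-i)^{b i}` is a matrix whose entries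
are linear forms (or zero), and a degree-preserving map `S(-d)^{b 0} → I` is a tuple of forms of
degree `d` in `I`. Such a resolution is automatically minimal, the entries of its matrices being
in the ideal generated by the variables. -/
def HasLinearResolution (I : Ideal (MvPolynomial V K)) : Prop :=
  ∃ (d : ℕ) (b : ℕ → ℕ) (g : Fin (b 0) → MvPolynomial V K)
    (A : ∀ i : ℕ, Matrix (Fin (b i)) (Fin (b (i + 1))) (MvPolynomial V K)),
    (∀ j, (g j).IsHomogeneous d) ∧
    (∀ i j k, (A i j k).IsHomogeneous 1) ∧
    Ideal.span (Set.range g) = I ∧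
    Function.Exact (A 0).mulVecLin (Fintype.linearCombination (MvPolynomial V K) g) ∧
    ∀ i, Function.Exact (A (i + 1)).mulVecLin (A i).mulVecLin

end Ideals

end CoverIdeal

namespace CoverIdeal

section LinearResolutions

open MvPolynomial

variable {R : Type*} [CommRing R] {V : Type*}

/-- The submodules of free modules that have an infinite linear resolution starting with
generators all of whose entries are linear forms: such a submodule is the range of a matrix of
linear forms whose kernel is again such a submodule, and so on forever. The definition is
coinductive: `P` is any property that can be continued in this way. -/
def IsLinearlyResolved {m : Type} (N : Submodule (MvPolynomial V R) (m → MvPolynomial V R)) :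
    Prop :=
  ∃ P : ∀ {m : Type}, Submodule (MvPolynomial V R) (m → MvPolynomial V R) → Prop, P N ∧
    ∀ {m : Type} (N : Submodule (MvPolynomial V R) (m → MvPolynomial V R)), P N →
      ∃ (n : Type) (_ : Fintype n) (A : Matrix m n (MvPolynomial V R)),
        (∀ i j, (A i j).IsHomogeneous 1) ∧ LinearMap.range A.mulVecLin = N ∧
        P (LinearMap.ker A.mulVecLin)

/-- Graded submodules of a free module with all basis vectors in degree `0`. -/
def IsGraded {m : Type*} (E : Submodule (MvPolynomial V R) (m → MvPolynomial V R)) : Prop :=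
  ∀ x ∈ E, ∀ e, (fun i => homogeneousComponent e (x i)) ∈ E

/-- The ideals that have a linear resolution with generators of degree `d`. -/
def HasLinearResolutionOfDegree (d : ℕ) (I : Ideal (MvPolynomial V R)) : Prop :=
  ∃ (n : Type) (_ : Fintype n) (g : n → MvPolynomial V R), (∀ j, (g j).IsHomogeneous d) ∧
    Ideal.span (Set.range g) = I ∧
    IsLinearlyResolved (LinearMap.ker (Fintype.linearCombination (MvPolynomial V R) g))

attribute [local instance] MvPolynomial.gradedAlgebra in
lemma homogeneousComponent_mul_of_isHomogeneous {a : MvPolynomial V R} {d : ℕ}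
    (ha : a.IsHomogeneous d) (e : ℕ) (p : MvPolynomial V R) :
    homogeneousComponent (d + e) (a * p) = a * homogeneousComponent e p := by
  classical
  have := DirectSum.coe_decompose_mul_add_of_left_mem (homogeneousSubmodule V R) (a := a)
    (b := p) (i := d) (j := e) ha
  rwa [← decomposition.decompose'_apply, ← decomposition.decompose'_apply]

lemma isGraded_ker_mulVecLin {m n : Type*} [Fintype n] {A : Matrix m n (MvPolynomial V R)} {d : ℕ}
    (hA : ∀ i j, (A i j).IsHomogeneous d) : IsGraded (LinearMap.ker A.mulVecLin) := by
  intro x hx e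
  ext1 i
  calc ∑ j, A i j * homogeneousComponent e (x j)
      = homogeneousComponent (d + e) (∑ j, A i j * x j) := by
        simp only [map_sum, homogeneousComponent_mul_of_isHomogeneous (hA i _)]
    _ = 0 := by rw [show ∑ j, A i j * x j = 0 from congrFun hx i, map_zero]

lemma isLinearlyResolved_iff {m : Type}
    {N : Submodule (MvPolynomial V R) (m → MvPolynomial V R)} : IsLinearlyResolved N ↔
      ∃ (n : Type) (_ : Fintype n) (A : Matrix m n (MvPolynomial V R)),
        (∀ i j, (A i j).IsHomogeneous 1) ∧ LinearMap.range A.mulVecLin = N ∧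
        IsLinearlyResolved (LinearMap.ker A.mulVecLin) := by
  constructor
  · rintro ⟨P, hN, hP⟩
    obtain ⟨n, _, A, hA, hrange, hker⟩ := hP N hN
    exact ⟨n, _, A, hA, hrange, P, hker, hP⟩
  · rintro ⟨n, _, A, hA, rfl, hker⟩
    refine ⟨fun N => IsLinearlyResolved N ∨ ∃ (n : Type) (_ : Fintype n) (A : Matrix _ n _),
      (∀ i j, (A i j).IsHomogeneous 1) ∧ LinearMap.range A.mulVecLin = N ∧
        IsLinearlyResolved (LinearMap.ker A.mulVecLin), .inr ⟨n, _, A, hA, rfl, hker⟩, ?_⟩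
    rintro m N (⟨P, hN, hP⟩ | ⟨n, _, A, hA, rfl, hker⟩)
    · obtain ⟨n, _, A, hA, hrange, hker⟩ := hP N hN
      exact ⟨n, _, A, hA, hrange, .inl ⟨P, hker, hP⟩⟩
    · exact ⟨n, _, A, hA, rfl, .inl hker⟩

lemma isLinearlyResolved_bot (m : Type) :
    IsLinearlyResolved (⊥ : Submodule (MvPolynomial V R) (m → MvPolynomial V R)) := by
  refine ⟨fun N => N = ⊥, rfl, ?_⟩
  rintro m _ rfl
  refine ⟨Empty, inferInstance, 0, fun _ j => j.elim, ?_, Subsingleton.elim _ _⟩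
  rw [Matrix.mulVecLin_zero, LinearMap.range_zero]

lemma exists_range_fromBlocks_eq {m m' n n' : Type*} [Fintype n] [Fintype n']
    {E : Submodule (MvPolynomial V R) (m ⊕ m' → MvPolynomial V R)} (hE : IsGraded E)
    {A : Matrix m n (MvPolynomial V R)} {C : Matrix m' n' (MvPolynomial V R)}
    (hC : ∀ i j, (C i j).IsHomogeneous 1)
    (hAE : ∀ y, y ∈ LinearMap.range A.mulVecLin ↔ Sum.elim y 0 ∈ E)
    (hCE : ∀ z, z ∈ LinearMap.range C.mulVecLin ↔ ∃ y, Sum.elim y z ∈ E) :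
    ∃ X : Matrix m n' (MvPolynomial V R), (∀ i j, (X i j).IsHomogeneous 1) ∧
      E = LinearMap.range (Matrix.fromBlocks A X 0 C).mulVecLin := by
  classical
  have lift (j : n') : ∃ y, Sum.elim y (C.col j) ∈ E :=
    (hCE _).1 ⟨Pi.single j 1, Matrix.mulVec_single_one C j⟩
  choose y hy using lift
  let X : Matrix m n' (MvPolynomial V R) := fun i j => homogeneousComponent 1 (y j i)
  have hX (j : n') : Sum.elim (X.col j) (C.col j) ∈ E := by
    convert hE _ (hy j) 1 using 1
    ext1 (i | i)
    · rfl
    · exact (homogeneousComponent_eq_self (hC i j)).symm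
  have hXC (v : n' → MvPolynomial V R) : Sum.elim (X.mulVec v) (C.mulVec v) ∈ E := by
    convert E.sum_mem (t := Finset.univ) fun j _ => E.smul_mem (v j) (hX j) using 1
    ext1 (i | i) <;> simp [Matrix.mulVec, dotProduct, mul_comm]
  refine ⟨X, fun i j => homogeneousComponent_isHomogeneous _ _, le_antisymm (fun x hx => ?_) ?_⟩
  · obtain ⟨v, hv⟩ : ∃ v, C.mulVec v = x ∘ Sum.inr :=
      (hCE _).2 ⟨x ∘ Sum.inl, by rwa [Sum.elim_comp_inl_inr]⟩
    obtain ⟨u, hu⟩ : ∃ u, A.mulVec u = x ∘ Sum.inl - X.mulVec v := by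
      refine (hAE _).2 ?_
      convert E.sub_mem hx (hXC v) using 1
      ext1 (i | i) <;> simp [hv]
    refine ⟨Sum.elim u v, ?_⟩
    rw [Matrix.mulVecLin_apply, Matrix.fromBlocks_mulVec, Sum.elim_comp_inl, Sum.elim_comp_inr,
      hu, hv]
    simp
  · rintro _ ⟨w, rfl⟩
    have hAw : Sum.elim (A.mulVec (w ∘ Sum.inl)) 0 ∈ E := (hAE _).1 ⟨_, rfl⟩
    convert E.add_mem hAw (hXC (w ∘ Sum.inr)) using 1
    rw [Matrix.mulVecLin_apply, Matrix.fromBlocks_mulVec]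
    ext1 (i | i) <;> simp

lemma sumElim_mem_ker_fromBlocks {m m' n n' : Type*} [Fintype n] [Fintype n']
    {A : Matrix m n R} {X : Matrix m n' R} {C : Matrix m' n' R} {y : n → R} {z : n' → R} :
    Sum.elim y z ∈ LinearMap.ker (Matrix.fromBlocks A X 0 C).mulVecLin ↔
      A.mulVec y + X.mulVec z = 0 ∧ C.mulVec z = 0 := by
  rw [LinearMap.mem_ker, Matrix.mulVecLin_apply, Matrix.fromBlocks_mulVec, ← Sum.elim_zero_zero]
  simp [-Sum.elim_zero_zero, Sum.elim_eq_iff]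

lemma exists_mulVec_add_mulVec_eq_zero {m m' n n' : Type*} [Fintype n] [Fintype n']
    {E : Submodule R (m ⊕ m' → R)} {A : Matrix m n R} {X : Matrix m n' R} {C : Matrix m' n' R}
    (hE : E = LinearMap.range (Matrix.fromBlocks A X 0 C).mulVecLin)
    (hAE : ∀ y, y ∈ LinearMap.range A.mulVecLin ↔ Sum.elim y 0 ∈ E) {z : n' → R}
    (hz : C.mulVec z = 0) : ∃ y, A.mulVec y + X.mulVec z = 0 := by
  obtain ⟨y, hy⟩ : ∃ y, A.mulVec y = X.mulVec z := by
    refine (hAE _).2 (hE ▸ ⟨Sum.elim 0 z, ?_⟩)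
    simp [Matrix.fromBlocks_mulVec, hz]
  exact ⟨-y, by rw [Matrix.mulVec_neg, hy, neg_add_cancel]⟩

-- The horseshoe lemma: the matrices of the resolution of `E` are block triangular.
theorem IsLinearlyResolved.of_extension {m m' : Type}
    {E : Submodule (MvPolynomial V R) (m ⊕ m' → MvPolynomial V R)} (hE : IsGraded E)
    {N : Submodule (MvPolynomial V R) (m → MvPolynomial V R)}
    {N' : Submodule (MvPolynomial V R) (m' → MvPolynomial V R)}
    (hN : IsLinearlyResolved N) (hN' : IsLinearlyResolved N')
    (hNE : ∀ y, y ∈ N ↔ Sum.elim y 0 ∈ E) (hN'E : ∀ z, z ∈ N' ↔ ∃ y, Sum.elim y z ∈ E) :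
    IsLinearlyResolved E := by
  refine ⟨fun {l} E => ∃ (m m' : Type) (h : l = (m ⊕ m'))
    (N : Submodule (MvPolynomial V R) (m → MvPolynomial V R))
    (N' : Submodule (MvPolynomial V R) (m' → MvPolynomial V R)),
    IsGraded E ∧ IsLinearlyResolved N ∧ IsLinearlyResolved N' ∧
    (∀ y, y ∈ N ↔ Sum.elim y (0 : m' → MvPolynomial V R) ∘ cast h ∈ E) ∧
    ∀ z, z ∈ N' ↔ ∃ y, Sum.elim y z ∘ cast h ∈ E,
    ⟨m, m', rfl, N, N', hE, hN, hN', hNE, hN'E⟩, ?_⟩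
  rintro _ E ⟨m, m', rfl, N, N', hE, hN, hN', hNE, hN'E⟩
  obtain ⟨n, _, A, hA, rfl, hkerA⟩ := isLinearlyResolved_iff.1 hN
  obtain ⟨n', _, C, hC, rfl, hkerC⟩ := isLinearlyResolved_iff.1 hN'
  obtain ⟨X, hX, hEX⟩ := exists_range_fromBlocks_eq hE hC hNE hN'E
  have hlin : ∀ i j, (Matrix.fromBlocks A X 0 C i j).IsHomogeneous 1 := by
    rintro (i | i) (j | j)
    exacts [hA i j, hX i j, isHomogeneous_zero _ _ _, hC i j]
  refine ⟨n ⊕ n', inferInstance, Matrix.fromBlocks A X 0 C, hlin, hEX.symm,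
    n, n', rfl, _, _, isGraded_ker_mulVecLin hlin, hkerA, hkerC, fun y => ?_, fun z => ?_⟩
  · exact .trans (by simp) sumElim_mem_ker_fromBlocks.symm
  · refine .trans ⟨fun hz => ?_, fun ⟨y, hy⟩ => hy.2⟩
      (exists_congr fun y => sumElim_mem_ker_fromBlocks.symm)
    exact (exists_mulVec_add_mulVec_eq_zero hEX hNE hz).imp fun y hy => ⟨hy, hz⟩

lemma replicateRow_mulVec_eq_linearCombination {m n : Type*} [Fintype n]
    (g x : n → R) :
    (Matrix.replicateRow m g).mulVec x = fun _ => Fintype.linearCombination R g x := by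
  rw [Matrix.replicateRow_mulVec_eq_const, dotProduct_comm]
  rfl

lemma isGraded_ker_linearCombination {n : Type*} [Fintype n] {g : n → MvPolynomial V R} {d : ℕ}
    (hg : ∀ j, (g j).IsHomogeneous d) :
    IsGraded (LinearMap.ker (Fintype.linearCombination (MvPolynomial V R) g)) := by
  convert isGraded_ker_mulVecLin (A := Matrix.replicateRow Unit g) fun _ => hg
  ext x
  simp [replicateRow_mulVec_eq_linearCombination, _root_.funext_iff]

lemma HasLinearResolutionOfDegree.isLinearlyResolved_comap_proj {J : Ideal (MvPolynomial V R)}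
    (hJ : HasLinearResolutionOfDegree 1 J) :
    IsLinearlyResolved (Submodule.comap (LinearMap.proj ()) J) := by
  obtain ⟨n, _, g, hg, rfl, hker⟩ := hJ
  refine isLinearlyResolved_iff.2
    ⟨n, inferInstance, Matrix.replicateRow Unit g, fun _ => hg, ?_, ?_⟩
  · ext x
    rw [Ideal.span, ← Fintype.range_linearCombination]
    simp [-Fintype.range_linearCombination, replicateRow_mulVec_eq_linearCombination,
      _root_.funext_iff, Unique.forall_iff]
  · convert hker
    ext x
    simp [replicateRow_mulVec_eq_linearCombination, _root_.funext_iff]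

lemma HasLinearResolutionOfDegree.sup_span_singleton {d : ℕ} {I J : Ideal (MvPolynomial V R)}
    {f : MvPolynomial V R} (hI : HasLinearResolutionOfDegree d I) (hf : f.IsHomogeneous d)
    (hJ : HasLinearResolutionOfDegree 1 J) (hcolon : ∀ p, p ∈ J ↔ p * f ∈ I) :
    HasLinearResolutionOfDegree d (I ⊔ Ideal.span {f}) := by
  obtain ⟨n, _, g, hg, rfl, hker⟩ := hI
  have hlin : ∀ j, (Sum.elim g (fun _ : Unit => f) j).IsHomogeneous d := by
    rintro (j | _)
    exacts [hg j, hf]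
  refine ⟨n ⊕ Unit, inferInstance, _, hlin, ?_, ?_⟩
  · rw [Set.Sum.elim_range, Ideal.span_union, Set.range_const]
  · refine IsLinearlyResolved.of_extension (isGraded_ker_linearCombination hlin) hker
      hJ.isLinearlyResolved_comap_proj (fun y => ?_) fun z => ?_
    · simp [Fintype.linearCombination_apply]
    · rw [Submodule.mem_comap, LinearMap.proj_apply, hcolon, ← neg_mem_iff, Ideal.span,
        ← Fintype.range_linearCombination]
      simp only [LinearMap.mem_range, eq_neg_iff_add_eq_zero]
      simp [Fintype.linearCombination_apply]

lemma hasLinearResolutionOfDegree_bot (d : ℕ) :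
    HasLinearResolutionOfDegree d (⊥ : Ideal (MvPolynomial V R)) := by
  refine ⟨Empty, inferInstance, Empty.elim, fun j => j.elim, by simp [Set.range_eq_empty], ?_⟩
  rw [Subsingleton.elim (LinearMap.ker _) ⊥]
  exact isLinearlyResolved_bot _

lemma IsLinearlyResolved.map_funCongrLeft {m m' : Type}
    {N : Submodule (MvPolynomial V R) (m → MvPolynomial V R)} (hN : IsLinearlyResolved N)
    (e : m' ≃ m) : IsLinearlyResolved
      (N.map (LinearEquiv.funCongrLeft (MvPolynomial V R) (MvPolynomial V R) e).toLinearMap) := by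
  obtain ⟨n, _, A, hA, rfl, hker⟩ := isLinearlyResolved_iff.1 hN
  have hreindex : (A.reindex e.symm (.refl n)).mulVecLin =
      (LinearEquiv.funCongrLeft _ _ e).toLinearMap ∘ₗ A.mulVecLin :=
    Matrix.mulVecLin_reindex _ _ _
  refine isLinearlyResolved_iff.2
    ⟨n, inferInstance, A.reindex e.symm (.refl n), fun i => hA _, ?_, ?_⟩
  · rw [hreindex, LinearMap.range_comp]
  · rwa [hreindex, LinearEquiv.ker_comp]

lemma IsLinearlyResolved.exists_matrix_fin {m : Type}
    {N : Submodule (MvPolynomial V R) (m → MvPolynomial V R)} (hN : IsLinearlyResolved N) :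
    ∃ (b : ℕ) (A : Matrix m (Fin b) (MvPolynomial V R)),
      (∀ i j, (A i j).IsHomogeneous 1) ∧ LinearMap.range A.mulVecLin = N ∧
      IsLinearlyResolved (LinearMap.ker A.mulVecLin) := by
  obtain ⟨n, _, A, hA, rfl, hker⟩ := isLinearlyResolved_iff.1 hN
  let e := Fintype.equivFin n
  have hreindex : (A.reindex (.refl m) e).mulVecLin =
      A.mulVecLin ∘ₗ (LinearEquiv.funCongrLeft _ _ e).toLinearMap :=
    Matrix.mulVecLin_reindex _ _ _
  refine ⟨_, A.reindex (.refl m) e, fun i j => hA _ _, ?_, ?_⟩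
  · rw [hreindex, LinearEquiv.range_comp]
  · rw [hreindex, LinearMap.ker_comp, Submodule.comap_equiv_eq_map_symm]
    exact hker.map_funCongrLeft e.symm

lemma HasLinearResolutionOfDegree.hasLinearResolution {K : Type*} [Field K] {d : ℕ}
    {I : Ideal (MvPolynomial V K)} (hI : HasLinearResolutionOfDegree d I) :
    HasLinearResolution I := by
  obtain ⟨n, _, g, hg, rfl, hker⟩ := hI
  let e := Fintype.equivFin n
  let Resolved := Σ b : ℕ, {N : Submodule (MvPolynomial V K) (Fin b → MvPolynomial V K) //
    IsLinearlyResolved N}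
  choose b A hA hrange hker' using fun N : Resolved => N.2.2.exists_matrix_fin
  let syzygies (i : ℕ) : Resolved :=
    i.rec ⟨_, _, hker.map_funCongrLeft e.symm⟩ fun _ N => ⟨b N, _, hker' N⟩
  refine ⟨d, fun i => (syzygies i).1, g ∘ e.symm, fun i => A (syzygies i),
    fun j => hg _, fun i => hA _, ?_, ?_, fun i => ?_⟩
  · rw [EquivLike.range_comp]
  · have hlin :
        Fintype.linearCombination (MvPolynomial V K) (g ∘ e.symm) =
        Fintype.linearCombination (MvPolynomial V K) g ∘ₗ
          (LinearEquiv.funCongrLeft (MvPolynomial V K) (MvPolynomial V K) e).toLinearMap :=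
      LinearMap.ext fun x => (Fintype.sum_equiv e _ _ fun j => by simp).symm
    rw [LinearMap.exact_iff, hrange, hlin, LinearMap.ker_comp, Submodule.comap_equiv_eq_map_symm]
    rfl
  · rw [LinearMap.exact_iff, hrange]

end LinearResolutions

section LinearQuotients

open MvPolynomial

variable {R : Type*} [CommRing R] {V : Type*}

lemma hasLinearResolutionOfDegree_span_X_image (s : Finset V) :
    HasLinearResolutionOfDegree 1 (Ideal.span (X '' (s : Set V) : Set (MvPolynomial V R))) := by
  classical
  induction s using Finset.induction_on with
  | empty => simpa using hasLinearResolutionOfDegree_bot 1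
  | insert x s hx ih =>
    rw [Finset.coe_insert, Set.image_insert_eq, Ideal.span_insert, sup_comm]
    refine ih.sup_span_singleton (isHomogeneous_X _ _) ih fun p =>
      ⟨Ideal.mul_mem_right _ _, fun hp => ?_⟩
    rw [mem_ideal_span_X_image] at hp ⊢
    intro μ hμ
    obtain ⟨i, hi, hμi⟩ := hp (μ + Finsupp.single x 1) (by
      rwa [mem_support_iff, coeff_mul_X, ← mem_support_iff])
    have hix : i ≠ x := by rintro rfl; exact hx hi
    exact ⟨i, hi, by simpa [hix] using hμi⟩

lemma mem_span_X_image_iff_mul_monomial_mem {s : Set (V →₀ ℕ)} {a : V →₀ ℕ} {T : Set V}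
    (hT : ∀ x ∈ T, ∃ g ∈ s, g ≤ a + Finsupp.single x 1) (hs : ∀ f ∈ s, ∃ x ∈ T, a x < f x)
    (p : MvPolynomial V R) :
    p ∈ Ideal.span (X '' T) ↔
      p * monomial a 1 ∈ Ideal.span ((fun e => monomial e (1 : R)) '' s) := by
  rw [mem_ideal_span_X_image, mem_ideal_span_monomial_image]
  constructor
  · intro hp μ hμ
    rw [mem_support_iff, coeff_mul_monomial', mul_one, ite_ne_right_iff, ← mem_support_iff] at hμ
    obtain ⟨x, hx, hμx⟩ := hp _ hμ.2
    obtain ⟨g, hg, hgx⟩ := hT x hx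
    refine ⟨g, hg, hgx.trans ?_⟩
    rw [← tsub_add_cancel_of_le hμ.1, add_comm a]
    gcongr
    rwa [Finsupp.single_le_iff, Nat.one_le_iff_ne_zero]
  · intro hp μ hμ
    obtain ⟨f, hf, hfμ⟩ := hp (μ + a) (by
      rwa [mem_support_iff, coeff_mul_monomial, mul_one, ← mem_support_iff])
    obtain ⟨x, hx, hax⟩ := hs f hf
    have := hfμ x
    rw [Finsupp.add_apply] at this
    exact ⟨x, hx, by omega⟩

-- Adding the generators in decreasing order of `φ`, every colon ideal is generated by variables.
theorem hasLinearResolutionOfDegree_of_linear_quotients [Finite V] {d : ℕ} (φ : (V →₀ ℕ) → ℕ)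
    (s : Finset (V →₀ ℕ)) (hd : ∀ e ∈ s, e.degree = d)
    (hs : ∀ e ∈ s, ∀ f ∈ s, e ≠ f → φ e ≤ φ f →
      ∃ g ∈ s, φ e < φ g ∧ ∃ x, e x < f x ∧ g ≤ e + Finsupp.single x 1) :
    HasLinearResolutionOfDegree d
      (Ideal.span ((fun e => monomial e (1 : R)) '' (s : Set (V →₀ ℕ)))) := by
  classical
  induction s using Finset.induction_on_min_value φ with
  | empty => simpa using hasLinearResolutionOfDegree_bot d
  | insert a s ha hmin ih =>
    simp only [Finset.forall_mem_insert] at hd hs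
    have mem_of_lt {e g} (he : e ∈ s) (hg : g ∈ insert a s) (hlt : φ e < φ g) : g ∈ s :=
      (Finset.mem_insert.1 hg).resolve_left fun h => (hmin e he).not_gt (h ▸ hlt)
    have hs' := ih hd.2 fun e he f hf hef hφ =>
      let ⟨g, hg, hlt, hx⟩ := (hs.2 e he).2 f hf hef hφ
      ⟨g, mem_of_lt he hg hlt, hlt, hx⟩
    let T : Set V := {x | ∃ g ∈ s, g ≤ a + Finsupp.single x 1}
    have hT : HasLinearResolutionOfDegree 1 (Ideal.span (X '' T : Set (MvPolynomial V R))) := by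
      simpa using hasLinearResolutionOfDegree_span_X_image (R := R) T.toFinite.toFinset
    rw [Finset.coe_insert, Set.image_insert_eq, Ideal.span_insert, sup_comm]
    refine hs'.sup_span_singleton (isHomogeneous_monomial _ hd.1) hT
      (mem_span_X_image_iff_mul_monomial_mem (fun x hx => hx) fun f hf => ?_)
    obtain ⟨g, hg, hlt, x, hax, hgx⟩ := hs.1.2 f hf (by rintro rfl; exact ha hf) (hmin f hf)
    exact ⟨x, ⟨g, (Finset.mem_insert.1 hg).resolve_left fun h => hlt.ne' (h ▸ rfl), hgx⟩, hax⟩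

end LinearQuotients

section VertexCovers

variable {V : Type*} {G : SimpleGraph V}

lemma isVertexCover_of_forall_adj {C D : Set V} (hC : G.IsVertexCover C)
    (hD : ∀ a ∈ C, a ∉ D → ∀ b, G.Adj a b → b ∈ D) : G.IsVertexCover D := by
  intro a b hab
  by_contra! hcon
  rcases hC hab with h | h
  · exact hcon.2 (hD a h hcon.1 b hab)
  · exact hcon.1 (hD b h hcon.2 a hab.symm)

/-- The finite sets of vertices that are minimal vertex covers. -/
abbrev IsMinimalVertexCover (G : SimpleGraph V) (C : Finset V) : Prop :=
  Minimal (fun D : Finset V => G.IsVertexCover (D : Set V)) C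

lemma isMinimalVertexCover_iff_exists_adj {C : Finset V} :
    IsMinimalVertexCover G C ↔
      G.IsVertexCover (C : Set V) ∧ ∀ v ∈ C, ∃ w, G.Adj v w ∧ w ∉ C := by
  classical
  refine ⟨fun hC => ⟨hC.1, fun v hv => ?_⟩, fun ⟨hC, h⟩ => ⟨hC, fun D hD hDC v hv => ?_⟩⟩
  · by_contra! hcon
    have herase : G.IsVertexCover (C.erase v : Set V) := by
      refine isVertexCover_of_forall_adj hC.1 fun a ha ha' b hab => ?_
      obtain rfl : a = v := by simpa [Finset.mem_coe.1 ha] using ha'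
      exact Finset.mem_erase.2 ⟨hab.ne', hcon b hab⟩
    exact Finset.notMem_erase v C (hC.2 herase (Finset.erase_subset v C) hv)
  · obtain ⟨w, hvw, hw⟩ := h v hv
    exact (hD hvw).resolve_right fun hwD => hw (hDC hwD)

end VertexCovers

section CoverExponents

open MvPolynomial

variable {V : Type*} {G : SimpleGraph V} {k : ℕ} {e : V →₀ ℕ}

/-- The exponents of the products of `k` generators of the cover ideal of `G`. -/
def coverExponents (G : SimpleGraph V) : ℕ → Set (V →₀ ℕ)
  | 0 => {0}
  | k + 1 => Set.image2 (fun e C => e + ∑ v ∈ C, Finsupp.single v 1) (coverExponents G k)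
      {C : Finset V | IsMinimalVertexCover G C}

lemma mem_coverExponents_succ : e ∈ coverExponents G (k + 1) ↔
    ∃ f ∈ coverExponents G k, ∃ C, IsMinimalVertexCover G C ∧
      f + ∑ v ∈ C, Finsupp.single v 1 = e :=
  Iff.rfl

lemma finite_coverExponents [Finite V] (G : SimpleGraph V) (k : ℕ) :
    (coverExponents G k).Finite := by
  induction k with
  | zero => exact Set.finite_singleton 0
  | succ k ih => exact ih.image2 _ (Set.toFinite _)

lemma coverIdeal_pow_eq_span (K : Type*) [Field K] (G : SimpleGraph V) (k : ℕ) :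
    coverIdeal K G ^ k = Ideal.span ((fun e => monomial e (1 : K)) '' coverExponents G k) := by
  induction k with
  | zero => simp [coverExponents, Ideal.one_eq_top]
  | succ k ih =>
    rw [pow_succ, ih, coverIdeal, Ideal.span_mul_span']
    congr 1
    have monomial_add_sum (e : V →₀ ℕ) (C : Finset V) :
        monomial (e + ∑ v ∈ C, Finsupp.single v 1) (1 : K) = monomial e 1 * ∏ v ∈ C, X v := by
      rw [← mul_one (1 : K), ← monomial_mul, monomial_sum_one, mul_one]
      rfl
    ext f
    constructor
    · rintro ⟨-, ⟨e, he, rfl⟩, -, ⟨C, hC, rfl⟩, rfl⟩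
      exact ⟨_, ⟨e, he, C, hC, rfl⟩, monomial_add_sum e C⟩
    · rintro ⟨-, ⟨e, he, C, hC, rfl⟩, rfl⟩
      exact ⟨_, ⟨e, he, rfl⟩, _, ⟨C, hC, rfl⟩, (monomial_add_sum e C).symm⟩

lemma sum_single_one_apply [DecidableEq V] (C : Finset V) (x : V) :
    (∑ v ∈ C, Finsupp.single v 1 : V →₀ ℕ) x = if x ∈ C then 1 else 0 := by
  simp [Finsupp.finsetSum_apply, Finsupp.single_apply]

lemma apply_le_of_mem_coverExponents (he : e ∈ coverExponents G k) (x : V) : e x ≤ k := by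
  classical
  induction k generalizing e with
  | zero => simp [Set.mem_singleton_iff.1 he]
  | succ k ih =>
    obtain ⟨f, hf, C, -, rfl⟩ := mem_coverExponents_succ.1 he
    rw [Finsupp.add_apply, sum_single_one_apply]
    exact add_le_add (ih hf) (by split_ifs <;> simp)

end CoverExponents

section SimplicialPartition

variable {V : Type*} {G : SimpleGraph V} {r : V → V}

/-- A partition of the vertices into closed neighbourhoods of simplicial vertices. It is encoded by
the map `r` that sends each vertex to the chosen simplicial vertex of its block: the blocks, i.e.
the fibres of `r`, are cliques, and all neighbours of `r v` are in the block of `v`. -/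
structure IsSimplicialPartition (G : SimpleGraph V) (r : V → V) : Prop where
  apply_apply : ∀ v, r (r v) = r v
  adj_of_apply_eq : ∀ ⦃v w⦄, v ≠ w → r v = r w → G.Adj v w
  apply_eq_of_adj : ∀ ⦃v w⦄, G.Adj (r v) w → r w = r v

namespace IsSimplicialPartition

variable (h : IsSimplicialPartition G r) {C D : Finset V}
include h

lemma injOn_compl (hC : G.IsVertexCover (C : Set V)) : Set.InjOn r (C : Set V)ᶜ := by
  intro v hv w hw hvw
  by_contra hne
  exact (hC (h.adj_of_apply_eq hne hvw)).elim hv hw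

lemma isMinimalVertexCover_iff : IsMinimalVertexCover G C ↔
    G.IsVertexCover (C : Set V) ∧ ∀ v, ∃ w ∉ C, r w = r v := by
  rw [isMinimalVertexCover_iff_exists_adj]
  refine and_congr_right fun _ => ⟨fun hC v => ?_, fun hC v hv => ?_⟩
  · by_cases hv : r v ∈ C
    · obtain ⟨w, hvw, hw⟩ := hC _ hv
      exact ⟨w, hw, h.apply_eq_of_adj hvw⟩
    · exact ⟨r v, hv, h.apply_apply v⟩
  · obtain ⟨w, hw, hwv⟩ := hC v
    exact ⟨w, h.adj_of_apply_eq (fun hvw => hw (hvw ▸ hv)) hwv.symm, hw⟩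

lemma isMinimalVertexCover_insert_erase [DecidableEq V] (hC : IsMinimalVertexCover G C) {x : V}
    (hx : x ∉ C) (hrx : r x ≠ x) : IsMinimalVertexCover G (insert x (C.erase (r x))) := by
  rw [h.isMinimalVertexCover_iff] at hC ⊢
  refine ⟨isVertexCover_of_forall_adj hC.1 fun a ha ha' b hab => ?_, fun v => ?_⟩
  · obtain rfl : a = r x := by
      by_contra hne
      exact ha' (Finset.mem_insert_of_mem (Finset.mem_erase.2 ⟨hne, ha⟩))
    have hb : b ∉ C → b = x := fun hb =>
      h.injOn_compl hC.1 hb hx (h.apply_eq_of_adj hab)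
    rw [Finset.mem_coe, Finset.mem_insert, Finset.mem_erase]
    exact (em (b ∈ C)).symm.imp hb fun hbC => ⟨hab.ne', hbC⟩
  · obtain ⟨w, hw, hwv⟩ := hC.2 v
    by_cases hwx : w = x
    · exact ⟨r x, by simp [hrx], by rw [h.apply_apply, ← hwx, hwv]⟩
    · exact ⟨w, by simp [hwx, hw], hwv⟩

lemma exists_isMinimalVertexCover_sum_add_single (hC : IsMinimalVertexCover G C) {x : V}
    (hx : x ∉ C) : ∃ D, IsMinimalVertexCover G D ∧
      ∑ v ∈ D, Finsupp.single v 1 + Finsupp.single (r x) 1 =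
        ∑ v ∈ C, Finsupp.single v 1 + Finsupp.single x 1 := by
  classical
  by_cases hrx : r x = x
  · exact ⟨C, hC, by rw [hrx]⟩
  have hrxC : r x ∈ C := by
    by_contra hrxC
    exact hrx (h.injOn_compl hC.1 hrxC hx (h.apply_apply x))
  refine ⟨_, h.isMinimalVertexCover_insert_erase hC hx hrx, ?_⟩
  rw [Finset.sum_insert (by simp [hx]), add_assoc, Finset.sum_erase_add _ _ hrxC, add_comm]

lemma exists_mem_coverExponents_add_single {k : ℕ} {e : V →₀ ℕ} (he : e ∈ coverExponents G k)
    {x : V} (hx : e x < k) : ∃ f ∈ coverExponents G k,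
      f + Finsupp.single (r x) 1 = e + Finsupp.single x 1 := by
  classical
  induction k generalizing e with
  | zero => simp at hx
  | succ k ih =>
    obtain ⟨e', he', C, hC, rfl⟩ := mem_coverExponents_succ.1 he
    by_cases hxC : x ∈ C
    · rw [Finsupp.add_apply, sum_single_one_apply, if_pos hxC, add_lt_add_iff_right] at hx
      obtain ⟨f, hf, hfe⟩ := ih he' hx
      exact ⟨_, ⟨f, hf, C, hC, rfl⟩, by rw [add_right_comm, hfe, add_right_comm]⟩
    · obtain ⟨D, hD, hDC⟩ := h.exists_isMinimalVertexCover_sum_add_single hC hxC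
      exact ⟨_, ⟨e', he', D, hD, rfl⟩, by rw [add_assoc, hDC, add_assoc]⟩

lemma mapDomain_sum_single_eq [Finite V] (hC : IsMinimalVertexCover G C)
    (hD : IsMinimalVertexCover G D) :
    Finsupp.mapDomain r (∑ v ∈ C, Finsupp.single v 1 : V →₀ ℕ) =
      Finsupp.mapDomain r (∑ v ∈ D, Finsupp.single v 1) := by
  classical
  have := Fintype.ofFinite V
  have image_compl {B : Finset V} (hB : IsMinimalVertexCover G B) :
      Bᶜ.image r = Finset.univ.image r := by
    refine Finset.Subset.antisymm (Finset.image_subset_image (Finset.subset_univ _)) fun u hu => ?_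
    obtain ⟨v, -, rfl⟩ := Finset.mem_image.1 hu
    obtain ⟨w, hw, hwv⟩ := (h.isMinimalVertexCover_iff.1 hB).2 v
    exact Finset.mem_image.2 ⟨w, Finset.mem_compl.2 hw, hwv⟩
  have sum_compl {B : Finset V} (hB : IsMinimalVertexCover G B) :
      ∑ v ∈ Bᶜ, Finsupp.single (r v) 1 = ∑ u ∈ Finset.univ.image r, Finsupp.single u 1 := by
    rw [← image_compl hB, Finset.sum_image]
    simpa using h.injOn_compl hB.1
  simp only [Finsupp.mapDomain_finsetSum, Finsupp.mapDomain_single]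
  refine add_right_cancel (b := ∑ u ∈ Finset.univ.image r, Finsupp.single u 1) ?_
  rw [← sum_compl hC, Finset.sum_add_sum_compl, sum_compl hC, ← sum_compl hD,
    Finset.sum_add_sum_compl]

lemma mapDomain_eq_of_mem_coverExponents [Finite V] {k : ℕ} {e f : V →₀ ℕ}
    (he : e ∈ coverExponents G k) (hf : f ∈ coverExponents G k) :
    Finsupp.mapDomain r e = Finsupp.mapDomain r f := by
  induction k generalizing e f with
  | zero => rw [Set.mem_singleton_iff.1 he, Set.mem_singleton_iff.1 hf]
  | succ k ih =>
    obtain ⟨e', he', C, hC, rfl⟩ := mem_coverExponents_succ.1 he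
    obtain ⟨f', hf', D, hD, rfl⟩ := mem_coverExponents_succ.1 hf
    rw [Finsupp.mapDomain_add, Finsupp.mapDomain_add, ih he' hf', h.mapDomain_sum_single_eq hC hD]

end IsSimplicialPartition

lemma eq_of_mapDomain_eq {e f : V →₀ ℕ} (hr : Finsupp.mapDomain r e = Finsupp.mapDomain r f)
    (hef : ∀ x, r x ≠ x → e x = f x) : e = f := by
  classical
  have mapDomain_filter (a : V →₀ ℕ) :
      Finsupp.mapDomain r (a.filter fun x => r x = x) = a.filter fun x => r x = x := by
    conv_rhs => rw [← Finsupp.mapDomain_id (v := a.filter fun x => r x = x)]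
    exact Finsupp.mapDomain_congr fun x hx => by simp_all
  have filter_ne : (e.filter fun x => r x ≠ x) = f.filter fun x => r x ≠ x := by
    ext x
    by_cases hx : r x = x <;> simp [hx, hef]
  rw [← Finsupp.filter_add_filter_not e fun x => r x = x,
    ← Finsupp.filter_add_filter_not f fun x => r x = x, Finsupp.mapDomain_add,
    Finsupp.mapDomain_add, mapDomain_filter, mapDomain_filter, filter_ne, add_left_inj] at hr
  rw [← Finsupp.filter_add_filter_not e fun x => r x = x, hr, filter_ne,
    Finsupp.filter_add_filter_not]

lemma exists_lt_of_mapDomain_eq [Fintype V] [DecidableEq V] {e f : V →₀ ℕ}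
    (hr : Finsupp.mapDomain r e = Finsupp.mapDomain r f) (hne : e ≠ f)
    (hle : ∑ x with r x ≠ x, e x ≤ ∑ x with r x ≠ x, f x) : ∃ x, r x ≠ x ∧ e x < f x := by
  by_contra! hfe
  have hfe' : ∀ x ∈ ({x | r x ≠ x} : Finset V), f x ≤ e x := fun x hx =>
    hfe x (Finset.mem_filter.1 hx).2
  have heq := (Finset.sum_eq_sum_iff_of_le hfe').1 ((Finset.sum_le_sum hfe').antisymm hle)
  exact hne (eq_of_mapDomain_eq hr fun x hx => (heq x (by simpa using hx)).symm)

theorem IsSimplicialPartition.hasLinearResolution_coverIdeal_pow [Finite V]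
    (h : IsSimplicialPartition G r) (K : Type*) [Field K] (k : ℕ) :
    HasLinearResolution (coverIdeal K G ^ k) := by
  classical
  have := Fintype.ofFinite V
  obtain ⟨d, hd⟩ : ∃ d, ∀ e ∈ coverExponents G k, e.degree = d := by
    rcases (coverExponents G k).eq_empty_or_nonempty with hempty | ⟨f, hf⟩
    · simp [hempty]
    · refine ⟨f.degree, fun e he => ?_⟩
      rw [← Finsupp.degree_mapDomain r, h.mapDomain_eq_of_mem_coverExponents he hf,
        Finsupp.degree_mapDomain]
  have hS := finite_coverExponents G k
  rw [coverIdeal_pow_eq_span, ← hS.coe_toFinset]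
  refine HasLinearResolutionOfDegree.hasLinearResolution (d := d) <|
    hasLinearResolutionOfDegree_of_linear_quotients (fun e => ∑ x with r x ≠ x, e x) _
      (by simpa using hd) ?_
  simp only [Set.Finite.mem_toFinset]
  intro e he f hf hne hle
  obtain ⟨x, hrx, hx⟩ :=
    exists_lt_of_mapDomain_eq (h.mapDomain_eq_of_mem_coverExponents he hf) hne hle
  obtain ⟨g, hg, hge⟩ := h.exists_mem_coverExponents_add_single he
    (hx.trans_le (apply_le_of_mem_coverExponents hf x))
  have hlt : ∑ y with r y ≠ y, g y = ∑ y with r y ≠ y, e y + 1 := by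
    simpa [Finset.sum_add_distrib, Finsupp.single_apply, h.apply_apply, hrx] using
      congrArg (fun e : V →₀ ℕ => ∑ y with r y ≠ y, e y) hge
  exact ⟨g, hg, by simp [hlt], x, hx, hge ▸ le_self_add⟩

end SimplicialPartition

section Unmixed

variable {V : Type*} {G : SimpleGraph V}

/-- A graph is unmixed if every minimal vertex cover has the smallest possible size. -/
def IsUnmixed (G : SimpleGraph V) : Prop :=
  ∀ ⦃C D : Finset V⦄, IsMinimalVertexCover G C → G.IsVertexCover (D : Set V) → C.card ≤ D.card

/-- The closed neighbourhood `N[A]`: the vertices that are in `A` or adjacent to a vertex of `A`. -/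
def closedNeighborhood (G : SimpleGraph V) (A : Set V) : Set V :=
  {v | ∃ a ∈ A, v = a ∨ G.Adj a v}

lemma closedNeighborhood_singleton (v : V) :
    closedNeighborhood G {v} = insert v (G.neighborSet v) := by
  ext w
  simp [closedNeighborhood]

/-- A vertex is simplicial if its closed neighbourhood is a clique. -/
def IsSimplicial (G : SimpleGraph V) (s : V) : Prop :=
  G.IsClique (closedNeighborhood G {s})

lemma isSimplicial_iff {s : V} : IsSimplicial G s ↔ G.IsClique (G.neighborSet s) := by
  rw [IsSimplicial, closedNeighborhood_singleton, SimpleGraph.isClique_insert]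
  exact and_iff_left fun _ hb _ => hb

lemma mem_closedNeighborhood_singleton_self (v : V) : v ∈ closedNeighborhood G {v} := by
  simp [closedNeighborhood_singleton]

lemma IsSimplicial.closedNeighborhood_subset {s v : V} (hs : IsSimplicial G s)
    (hv : v ∈ closedNeighborhood G {s}) :
    closedNeighborhood G {s} ⊆ closedNeighborhood G {v} := by
  intro w hw
  rw [closedNeighborhood_singleton]
  exact (eq_or_ne w v).imp id fun hne => hs hv hw hne.symm

theorem IsUnmixed.ncard_le_ncard_of_closedNeighborhood_subset [Finite V] (hG : IsUnmixed G)
    {A B : Set V} (hA : G.IsIndepSet A) (hB : G.IsIndepSet B)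
    (hBA : closedNeighborhood G B ⊆ closedNeighborhood G A) : B.ncard ≤ A.ncard := by
  classical
  have := Fintype.ofFinite V
  lift A to Finset V using A.toFinite
  lift B to Finset V using B.toFinite
  simp only [Set.ncard_coe_finset]
  obtain ⟨C, hCA, hC⟩ := exists_minimal_le_of_wellFoundedLT
    (fun D : Finset V => G.IsVertexCover (D : Set V)) Aᶜ (by simpa using hA)
  have hdisj : Disjoint C A := by
    rw [← le_compl_iff_disjoint_right]
    exact hCA
  have hNA : closedNeighborhood G A ⊆ (C ∪ A : Finset V) := by
    rintro v ⟨a, ha, rfl | hav⟩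
    · exact Finset.mem_union_right _ ha
    · exact Finset.mem_union_left _ ((hC.1 hav).resolve_left (Finset.disjoint_right.1 hdisj ha))
  have hBsub : B ⊆ C ∪ A := fun b hb => hNA (hBA ⟨b, hb, .inl rfl⟩)
  -- Exchanging `B` for `A` in a minimal vertex cover that misses `A` gives a vertex cover again.
  have hD : G.IsVertexCover (((C ∪ A) \ B : Finset V) : Set V) := by
    have hCA' : G.IsVertexCover ((C ∪ A : Finset V) : Set V) := hC.1.subset (by simp)
    refine isVertexCover_of_forall_adj hCA' fun b hb hbD c hbc => ?_
    have hbB : b ∈ B := by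
      by_contra hbB
      exact hbD (Finset.mem_sdiff.2 ⟨hb, hbB⟩)
    exact Finset.mem_sdiff.2
      ⟨hNA (hBA ⟨b, hbB, .inr hbc⟩), fun hcB => hB hbB hcB hbc.ne hbc⟩
  have hcard := hG hC hD
  rw [Finset.card_sdiff_of_subset hBsub, Finset.card_union_of_disjoint hdisj] at hcard
  have := Finset.card_le_card hBsub
  rw [Finset.card_union_of_disjoint hdisj] at this
  omega

lemma IsUnmixed.closedNeighborhood_eq [Finite V] (hG : IsUnmixed G) {s t v : V}
    (hs : IsSimplicial G s) (ht : IsSimplicial G t) (hvs : v ∈ closedNeighborhood G {s})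
    (hvt : v ∈ closedNeighborhood G {t}) :
    closedNeighborhood G {s} = closedNeighborhood G {t} := by
  classical
  suffices hst : t ∈ closedNeighborhood G {s} by
    have hts : s ∈ closedNeighborhood G {t} := by
      rw [closedNeighborhood_singleton] at hst ⊢
      exact hst.imp Eq.symm SimpleGraph.Adj.symm
    exact (hs.closedNeighborhood_subset hst).antisymm (ht.closedNeighborhood_subset hts)
  by_contra hst
  rw [closedNeighborhood_singleton, Set.mem_insert_iff, not_or, SimpleGraph.mem_neighborSet] at hst
  have hle := hG.ncard_le_ncard_of_closedNeighborhood_subset (A := {v}) (B := {s, t}) (by simp)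
    (by simp [SimpleGraph.isIndepSet_iff, Set.pairwise_pair, hst.2, G.adj_comm t s]) (by
      rintro w ⟨b, rfl | rfl, hw⟩
      · exact hs.closedNeighborhood_subset hvs ⟨b, rfl, hw⟩
      · exact ht.closedNeighborhood_subset hvt ⟨b, rfl, hw⟩)
  rw [Set.ncard_pair (Ne.symm hst.1), Set.ncard_singleton] at hle
  omega

theorem IsUnmixed.exists_isSimplicialPartition [Finite V] (hG : IsUnmixed G)
    (h : ∀ v, ∃ s, IsSimplicial G s ∧ v ∈ closedNeighborhood G {s}) :
    ∃ r, IsSimplicialPartition G r := by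
  rcases isEmpty_or_nonempty V with hV | hV
  · exact ⟨id, isEmptyElim, isEmptyElim, isEmptyElim⟩
  choose s hs hvs using h
  let N : V → Set V := fun v => closedNeighborhood G {v}
  let r : V → V := fun v => Function.invFunOn N {t | IsSimplicial G t} (N (s v))
  have hex (v : V) : ∃ t ∈ {t | IsSimplicial G t}, N t = N (s v) := ⟨s v, hs v, rfl⟩
  have isSimplicial_r (v : V) : IsSimplicial G (r v) := Function.invFunOn_mem (hex v)
  have N_r (v : V) : N (r v) = N (s v) := Function.invFunOn_eq (hex v)
  have mem_N_r (v : V) : v ∈ N (r v) := N_r v ▸ hvs v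
  have r_eq {v w : V} (hvw : w ∈ N (r v)) : r w = r v := by
    have hN : N (s w) = N (s v) :=
      N_r v ▸ hG.closedNeighborhood_eq (hs w) (isSimplicial_r v) (hvs w) hvw
    simp only [r, hN]
  refine ⟨r, fun v => r_eq (mem_closedNeighborhood_singleton_self _), fun v w hne hvw => ?_,
    fun v w hvw => r_eq ⟨_, rfl, .inr hvw⟩⟩
  exact isSimplicial_r v (mem_N_r v) (hvw ▸ mem_N_r w) hne

end Unmixed

section Matchings

variable {V : Type*} {G : SimpleGraph V} {M : G.Subgraph}

lemma isMatching_sup_subgraphOfAdj (hM : M.IsMatching) {a b : V} (hab : G.Adj a b)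
    (ha : a ∉ M.verts) (hb : b ∉ M.verts) : (M ⊔ G.subgraphOfAdj hab).IsMatching := by
  refine hM.sup (.subgraphOfAdj hab) ?_
  rw [hM.support_eq_verts, SimpleGraph.support_subgraphOfAdj, Set.disjoint_right]
  rintro x (rfl | rfl)
  exacts [ha, hb]

lemma isMatching_deleteVerts (hM : M.IsMatching) {a b : V} (hab : M.Adj a b) :
    (M.deleteVerts {a, b}).IsMatching := by
  rintro v ⟨hv, hvab⟩
  simp only [Set.mem_insert_iff, Set.mem_singleton_iff, not_or] at hvab
  obtain ⟨w, hw, huniq⟩ := hM hv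
  refine ⟨w, ?_, fun y hy => huniq y (SimpleGraph.Subgraph.deleteVerts_adj.1 hy).2.2.2.2⟩
  refine SimpleGraph.Subgraph.deleteVerts_adj.2
    ⟨hv, by simp [hvab], M.edge_vert hw.symm, ?_, hw⟩
  rintro (rfl | rfl)
  · exact hvab.2 (hM.eq_of_adj_left hw.symm hab)
  · exact hvab.1 (hM.eq_of_adj_right hw hab)

lemma two_mul_ncard_edgeSet [Finite V] (hM : M.IsMatching) :
    2 * M.edgeSet.ncard = M.verts.ncard := by
  classical
  have := Fintype.ofFinite V
  have degree_eq (v : V) : M.spanningCoe.degree v = if v ∈ M.verts then 1 else 0 := by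
    rw [SimpleGraph.Subgraph.degree_spanningCoe]
    split_ifs with hv
    · exact SimpleGraph.Subgraph.isMatching_iff_forall_degree.1 hM v hv
    · exact SimpleGraph.Subgraph.degree_of_notMem_verts hv
  have hsum := M.spanningCoe.sum_degrees_eq_twice_card_edges
  simp only [degree_eq, Finset.sum_boole] at hsum
  rw [← SimpleGraph.Subgraph.edgeSet_spanningCoe, ← SimpleGraph.coe_edgeFinset,
    Set.ncard_coe_finset, ← hsum, Nat.cast_id, ← Set.ncard_coe_finset]
  simp

lemma exists_isMatching_of_augmenting_path [Finite V] (hM : M.IsMatching) {u x y v : V}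
    (hux : G.Adj u x) (hxy : M.Adj x y) (hyv : G.Adj y v) (hu : u ∉ M.verts) (hv : v ∉ M.verts)
    (huv : u ≠ v) : ∃ M' : G.Subgraph, M'.IsMatching ∧ M'.verts.ncard = M.verts.ncard + 2 := by
  have hx := M.edge_vert hxy
  have hy := M.edge_vert hxy.symm
  have hyx : y ≠ x := hxy.ne.symm
  have hyu : y ≠ u := fun h => hu (h ▸ hy)
  have hvx : v ≠ x := fun h => hv (h ▸ hx)
  refine ⟨(M.deleteVerts {x, y} ⊔ G.subgraphOfAdj hux) ⊔ G.subgraphOfAdj hyv,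
    isMatching_sup_subgraphOfAdj (isMatching_sup_subgraphOfAdj (isMatching_deleteVerts hM hxy) _
      (by simp [hu]) (by simp)) _ (by simp [hyu, hyx]) (by simp [hv, huv.symm, hvx]), ?_⟩
  have hverts : ((M.deleteVerts {x, y} ⊔ G.subgraphOfAdj hux) ⊔ G.subgraphOfAdj hyv).verts =
      insert u (insert v M.verts) := by
    ext w
    simp only [SimpleGraph.Subgraph.verts_sup, SimpleGraph.Subgraph.deleteVerts_verts,
      SimpleGraph.subgraphOfAdj_verts, Set.mem_union, Set.mem_sdiff, Set.mem_insert_iff,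
      Set.mem_singleton_iff]
    grind
  rw [hverts, Set.ncard_insert_of_notMem (by simp [huv, hu]), Set.ncard_insert_of_notMem hv]

/-- A matching of the largest possible size that is also an induced subgraph. -/
structure IsInducedMaximumMatching (M : G.Subgraph) : Prop where
  isMatching : M.IsMatching
  isInduced : M.IsInduced
  ncard_verts_le : ∀ ⦃M' : G.Subgraph⦄, M'.IsMatching → M'.verts.ncard ≤ M.verts.ncard

lemma exists_isInducedMaximumMatching [Finite V]
    (h : inducedMatchingNumber G = matchingNumber G) :
    ∃ M : G.Subgraph, IsInducedMaximumMatching M := by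
  have bddAbove (P : G.Subgraph → Prop) :
      BddAbove {n | ∃ M : G.Subgraph, P M ∧ M.edgeSet.ncard = n} :=
    ⟨Nat.card (Sym2 V), by rintro _ ⟨M, -, rfl⟩; exact Set.ncard_le_card _⟩
  obtain ⟨M, hM, hind, hcard⟩ : inducedMatchingNumber G ∈
      {n | ∃ M : G.Subgraph, M.IsMatching ∧ M.IsInduced ∧ M.edgeSet.ncard = n} := by
    refine Nat.sSup_mem ⟨_, ⊥, fun v hv => hv.elim, fun v hv => hv.elim, rfl⟩ ?_
    simpa only [and_assoc] using bddAbove fun M => M.IsMatching ∧ M.IsInduced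
  refine ⟨M, hM, hind, fun M' hM' => ?_⟩
  rw [← two_mul_ncard_edgeSet hM, ← two_mul_ncard_edgeSet hM', hcard, h]
  exact Nat.mul_le_mul_left 2 (le_csSup (bddAbove _) ⟨M', hM', rfl⟩)

namespace IsInducedMaximumMatching

variable (h : IsInducedMaximumMatching M)
include h

lemma adj_of_adj {x y : V} (hx : x ∈ M.verts) (hy : y ∈ M.verts) (hxy : G.Adj x y) : M.Adj x y :=
  h.isInduced hx hy hxy

variable [Finite V]

lemma not_adj {u v : V} (hu : u ∉ M.verts) (hv : v ∉ M.verts) : ¬ G.Adj u v := by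
  intro huv
  have hle := h.ncard_verts_le (isMatching_sup_subgraphOfAdj h.isMatching huv hu hv)
  have hlt : M.verts.ncard < (M ⊔ G.subgraphOfAdj huv).verts.ncard :=
    Set.ncard_lt_ncard ⟨Set.subset_union_left, fun hsub => hu (hsub (by simp))⟩
  omega

lemma eq_of_adj {u x y v : V} (hux : G.Adj u x) (hxy : M.Adj x y) (hyv : G.Adj y v)
    (hu : u ∉ M.verts) (hv : v ∉ M.verts) : u = v := by
  by_contra huv
  obtain ⟨M', hM', hcard⟩ := exists_isMatching_of_augmenting_path h.isMatching hux hxy hyv hu hv huv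
  have := h.ncard_verts_le hM'
  omega

lemma isSimplicial_of_adj {x y : V} (hxy : M.Adj x y)
    (hy : ∀ u ∉ M.verts, G.Adj u x → G.Adj u y) : IsSimplicial G x := by
  have hx := M.edge_vert hxy
  have eq_or_adj {a : V} (ha : G.Adj x a) : a = y ∨ (a ∉ M.verts ∧ G.Adj a y) := by
    by_cases haM : a ∈ M.verts
    · exact .inl (h.isMatching.eq_of_adj_left (h.adj_of_adj hx haM ha) hxy)
    · exact .inr ⟨haM, hy a haM ha.symm⟩
  rw [isSimplicial_iff]
  intro a ha b hb hab
  rcases eq_or_adj ha with rfl | ⟨haM, hay⟩ <;> rcases eq_or_adj hb with rfl | ⟨hbM, hby⟩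
  · exact absurd rfl hab
  · exact hby.symm
  · exact hay
  · exact absurd (h.eq_of_adj (G.adj_symm ha) hxy hby.symm haM hbM) hab

lemma eq_or_eq_of_adj {u x y w : V} (hux : G.Adj u x) (hxy : M.Adj x y) (hyw : G.Adj y w)
    (hu : u ∉ M.verts) : w = x ∨ w = u := by
  by_cases hw : w ∈ M.verts
  · exact .inl (h.isMatching.eq_of_adj_left (h.adj_of_adj (M.edge_vert hxy.symm) hw hyw) hxy.symm)
  · exact .inr (h.eq_of_adj hux hxy hyw hu hw).symm

lemma mem_verts_of_adj {u x : V} (hu : u ∉ M.verts) (hux : G.Adj u x) : x ∈ M.verts :=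
  by_contra fun hx => h.not_adj hu hx hux

lemma isIndepSet_neighborSet {u : V} (hu : u ∉ M.verts)
    (htri : ∀ x y, M.Adj x y → G.Adj u x → ¬ G.Adj u y) : G.IsIndepSet (G.neighborSet u) := by
  intro x hux y huy _ hxy
  exact htri x y (h.adj_of_adj (h.mem_verts_of_adj hu hux) (h.mem_verts_of_adj hu huy) hxy) hux huy

lemma isIndepSet_insert_partners {u : V} (hu : u ∉ M.verts)
    (htri : ∀ x y, M.Adj x y → G.Adj u x → ¬ G.Adj u y) :
    G.IsIndepSet (insert u {y | ∃ x, G.Adj u x ∧ M.Adj x y}) := by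
  have not_adj_of_mem {y : V} (hy : y ∈ insert u {y | ∃ x, G.Adj u x ∧ M.Adj x y}) :
      ¬ G.Adj u y := by
    rcases hy with rfl | ⟨x, hux, hxy⟩
    exacts [G.irrefl, htri x y hxy hux]
  rintro a (rfl | ⟨x, hux, hxa⟩) b hb - hab
  · exact not_adj_of_mem hb hab
  · rcases h.eq_or_eq_of_adj hux hxa hab hu with rfl | rfl
    exacts [not_adj_of_mem hb hux, htri x a hxa hux hab.symm]

lemma closedNeighborhood_insert_partners_subset {u : V} (hu : u ∉ M.verts)
    (hne : (G.neighborSet u).Nonempty) :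
    closedNeighborhood G (insert u {y | ∃ x, G.Adj u x ∧ M.Adj x y}) ⊆
      closedNeighborhood G (G.neighborSet u) := by
  have hu_mem : u ∈ closedNeighborhood G (G.neighborSet u) :=
    let ⟨x, hux⟩ := hne; ⟨x, hux, .inr hux.symm⟩
  rintro w ⟨y, rfl | ⟨x, hux, hxy⟩, rfl | hyw⟩
  · exact hu_mem
  · exact ⟨w, hyw, .inl rfl⟩
  · exact ⟨x, hux, .inr hxy.adj_sub⟩
  · rcases h.eq_or_eq_of_adj hux hxy hyw hu with rfl | rfl
    exacts [⟨w, hux, .inl rfl⟩, hu_mem]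

lemma ncard_neighborSet_lt {u : V} (hu : u ∉ M.verts) :
    (G.neighborSet u).ncard < (insert u {y | ∃ x, G.Adj u x ∧ M.Adj x y}).ncard := by
  choose! τ hτ using fun x (hx : x ∈ M.verts) => (h.isMatching hx).exists
  have adj_τ {x : V} (hx : x ∈ G.neighborSet u) : M.Adj x (τ x) :=
    hτ x (h.mem_verts_of_adj hu hx)
  rw [Set.ncard_insert_of_notMem (by rintro ⟨x, -, hxu⟩; exact hu (M.edge_vert hxu.symm)),
    Nat.lt_succ_iff]
  exact Set.ncard_le_ncard_of_injOn τ (fun x hx => ⟨x, hx, adj_τ hx⟩) fun x hx y hy hxy =>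
    h.isMatching.eq_of_adj_right (adj_τ hx) (hxy ▸ adj_τ hy)

lemma exists_triangle (hG : IsUnmixed G) {u : V} (hu : u ∉ M.verts)
    (hne : (G.neighborSet u).Nonempty) : ∃ x y, M.Adj x y ∧ G.Adj u x ∧ G.Adj u y := by
  by_contra! htri
  exact (h.ncard_neighborSet_lt hu).not_ge <| hG.ncard_le_ncard_of_closedNeighborhood_subset
    (h.isIndepSet_neighborSet hu htri) (h.isIndepSet_insert_partners hu htri)
    (h.closedNeighborhood_insert_partners_subset hu hne)

lemma exists_isSimplicial (hG : IsUnmixed G) (v : V) :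
    ∃ s, IsSimplicial G s ∧ v ∈ closedNeighborhood G {s} := by
  simp only [closedNeighborhood_singleton, Set.mem_insert_iff, SimpleGraph.mem_neighborSet]
  by_cases hv : v ∈ M.verts
  · obtain ⟨w, hvw, -⟩ := h.isMatching hv
    by_cases hvsimp : ∀ u ∉ M.verts, G.Adj u v → G.Adj u w
    · exact ⟨v, h.isSimplicial_of_adj hvw hvsimp, .inl rfl⟩
    · push Not at hvsimp
      obtain ⟨u, hu, huv, -⟩ := hvsimp
      refine ⟨w, h.isSimplicial_of_adj hvw.symm fun u' hu' hu'w => ?_, .inr hvw.adj_sub.symm⟩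
      rwa [← h.eq_of_adj huv hvw hu'w.symm hu hu']
  · rcases (G.neighborSet v).eq_empty_or_nonempty with hempty | hne
    · exact ⟨v, by simp [isSimplicial_iff, hempty], .inl rfl⟩
    · obtain ⟨x, y, hxy, hvx, hvy⟩ := h.exists_triangle hG hv hne
      refine ⟨x, h.isSimplicial_of_adj hxy fun u hu hux => ?_, .inr hvx.symm⟩
      rwa [h.eq_of_adj hux hxy hvy.symm hu hv]

end IsInducedMaximumMatching

end Matchings

section Depth

open IsLocalRing RingTheory.Sequence Submodule
open scoped Pointwise

variable {R M : Type*} [CommRing R] [IsNoetherianRing R] [IsLocalRing R] [AddCommGroup M]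
  [Module R M] [Module.Finite R M]

lemma eq_bot_of_torsionBySet_le_smul_top {x : R} (hx : x ∈ maximalIdeal R)
    (hreg : IsSMulRegular M x) {s : Set R} (hle : torsionBySet R M s ≤ x • ⊤) :
    torsionBySet R M s = ⊥ := by
  refine eq_bot_of_le_smul_of_le_jacobson_bot (Ideal.span {x}) _ (IsNoetherian.noetherian _)
    (fun n hn => ?_) ?_
  · obtain ⟨m, -, rfl⟩ := (mem_smul_pointwise_iff_exists _ _ _).1 (hle hn)
    refine smul_mem_smul (Ideal.mem_span_singleton_self x) ?_
    rw [mem_torsionBySet_iff] at hn ⊢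
    refine fun r => hreg ?_
    simpa only [smul_zero, smul_comm x] using hn r
  · rwa [jacobson_eq_maximalIdeal _ bot_ne_top, Ideal.span_singleton_le_iff_mem]

lemma exists_isAssociatedPrime_quotSMulTop {x : R} (hx : x ∈ maximalIdeal R)
    (hreg : IsSMulRegular M x) {p : Ideal R} (hp : IsAssociatedPrime p M) :
    ∃ q : Ideal R, IsAssociatedPrime q (QuotSMulTop x M) ∧ p ≤ q ∧ x ∈ q := by
  obtain ⟨hprime, m, hm⟩ := isAssociatedPrime_iff.1 hp
  have hmp : m ∈ torsionBySet R M p := by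
    rw [mem_torsionBySet_iff]
    rintro ⟨r, hr⟩
    simpa only [hm, SetLike.mem_coe, mem_colon_singleton, mem_bot] using hr
  obtain ⟨n, hn, hnx⟩ : ∃ n ∈ torsionBySet R M p, n ∉ x • (⊤ : Submodule R M) := by
    by_contra! hle
    rw [eq_bot_of_torsionBySet_le_smul_top hx hreg hle, mem_bot] at hmp
    exact hprime.ne_top ((Ideal.eq_top_iff_one p).2 (by simp [hm, hmp]))
  obtain ⟨q, hq, hle⟩ := exists_le_isAssociatedPrime_of_isNoetherianRing R
    (Submodule.Quotient.mk n : QuotSMulTop x M) (by rwa [ne_eq, Quotient.mk_eq_zero])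
  have mem_q {r : R} (hr : r • n ∈ x • (⊤ : Submodule R M)) : r ∈ q := hle <| by
    rwa [mem_colon_singleton, mem_bot, ← Quotient.mk_smul, Quotient.mk_eq_zero]
  rw [mem_torsionBySet_iff] at hn
  exact ⟨q, hq, fun r hr => mem_q (hn ⟨r, hr⟩ ▸ zero_mem _),
    mem_q (smul_mem_pointwise_smul _ _ _ trivial)⟩

theorem length_le_ringKrullDim_quotient {rs : List R} (hrs : IsWeaklyRegular M rs)
    (hmem : ∀ r ∈ rs, r ∈ maximalIdeal R) {p : Ideal R} (hp : IsAssociatedPrime p M) :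
    (rs.length : WithBot ℕ∞) ≤ ringKrullDim (R ⧸ p) := by
  have hprime := hp.isPrime
  induction rs generalizing M p with
  | nil => simpa using ringKrullDim_nonneg_of_nontrivial
  | cons x rs ih =>
    rw [isWeaklyRegular_cons_iff] at hrs
    rw [List.forall_mem_cons] at hmem
    obtain ⟨q, hq, hpq, hxq⟩ := exists_isAssociatedPrime_quotSMulTop hmem.1 hrs.1 hp
    have hxp : x ∉ p := fun hxp =>
      (biUnion_associatedPrimes_eq_compl_regular R M).subset (Set.mem_biUnion hp hxp) hrs.1
    calc ((x :: rs).length : WithBot ℕ∞) = rs.length + 1 := by simp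
      _ ≤ ringKrullDim (R ⧸ q) + 1 := by gcongr; exact ih hrs.2 hmem.2 hq hq.isPrime
      _ ≤ ringKrullDim (R ⧸ p) := ringKrullDim_succ_le_of_surjective (Ideal.Quotient.factor hpq)
        (Ideal.Quotient.factor_surjective hpq) (r := Ideal.Quotient.mk p x)
        (mem_nonZeroDivisors_of_ne_zero (by rwa [ne_eq, Ideal.Quotient.eq_zero_iff_mem]))
        (by rwa [Ideal.Quotient.factor_mk, Ideal.Quotient.eq_zero_iff_mem])

theorem localDepth_le_ringKrullDim_quotient {p : Ideal R} (hp : IsAssociatedPrime p R) :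
    (localDepth R : WithBot ℕ∞) ≤ ringKrullDim (R ⧸ p) := by
  have hprime := hp.isPrime
  obtain ⟨n, hn⟩ : ∃ n : ℕ∞, ringKrullDim (R ⧸ p) = n :=
    (WithBot.ne_bot_iff_exists.1 (ne_bot_of_le_ne_bot WithBot.zero_ne_bot
      ringKrullDim_nonneg_of_nontrivial)).imp fun _ h => h.symm
  rw [hn, WithBot.coe_le_coe]
  refine iSup₂_le fun rs hrs => ?_
  have := length_le_ringKrullDim_quotient hrs.1.toIsWeaklyRegular hrs.2 hp
  rw [hn] at this
  exact_mod_cast this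

lemma ringKrullDim_quotient_le_card {q : Ideal R} (s : Finset R)
    (hs : maximalIdeal R = q ⊔ Ideal.span s) : ringKrullDim (R ⧸ q) ≤ s.card := by
  classical
  have hq : q ≠ ⊤ := ne_top_of_le_ne_top (Ideal.IsPrime.ne_top') (hs ▸ le_sup_left)
  have : Nontrivial (R ⧸ q) := Ideal.Quotient.nontrivial_iff.2 hq
  have : IsLocalRing (R ⧸ q) := .of_surjective' (Ideal.Quotient.mk q) Ideal.Quotient.mk_surjective
  have hmax : maximalIdeal (R ⧸ q) =
      Ideal.span (s.image (Ideal.Quotient.mk q) : Finset (R ⧸ q)) := by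
    rw [← map_maximalIdeal_of_surjective _ Ideal.Quotient.mk_surjective, hs, Ideal.map_sup,
      Ideal.map_quotient_self, bot_sup_eq, Ideal.map_span, Finset.coe_image]
  refine (ringKrullDim_le_spanFinrank_maximalIdeal (R ⧸ q)).trans (Nat.cast_le.2 ?_)
  rw [hmax]
  refine (spanFinrank_span_le_ncard_of_finite (Finset.finite_toSet _)).trans ?_
  rw [Set.ncard_coe_finset]
  exact Finset.card_image_le

end Depth

section CohenMacaulay

open Module.associatedPrimes

theorem IsCohenMacaulayRing.height_le_card {A : Type*} [CommRing A] (hA : IsCohenMacaulayRing A)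
    {p q : Ideal A} [p.IsMaximal] (hq : IsAssociatedPrime q A) (s : Finset A)
    (hp : p = q ⊔ Ideal.span s) : p.height ≤ s.card := by
  classical
  have := hA.noetherian
  let R := Localization.AtPrime p
  let qR : Ideal R := q.map (algebraMap A R)
  have hqR : IsAssociatedPrime qR R := by
    have hdisj : Disjoint (p.primeCompl : Set A) q :=
      Set.disjoint_left.2 fun _ hxp hxq => hxp (hp ▸ Ideal.mem_sup_left hxq)
    have hcomap : qR.comap (algebraMap A R) = q :=
      IsLocalization.under_map_of_isPrime_disjoint p.primeCompl R hq.isPrime hdisj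
    apply mem_associatedPrimes_of_comap_mem_associatedPrimes_of_isLocalizedModule
      p.primeCompl (Algebra.linearMap A R)
    rwa [hcomap]
  have hmax : IsLocalRing.maximalIdeal R =
      qR ⊔ Ideal.span (s.image (algebraMap A R) : Finset R) := by
    rw [← Localization.AtPrime.map_eq_maximalIdeal, Finset.coe_image, ← Ideal.map_span,
      ← Ideal.map_sup, ← hp]
  have h : (p.height : WithBot ℕ∞) ≤ (s.card : ℕ∞) := by
    calc (p.height : WithBot ℕ∞) = ringKrullDim R :=
          (IsLocalization.AtPrime.ringKrullDim_eq_height p R).symm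
      _ = localDepth R := (hA.depth_eq_dim p).symm
      _ ≤ ringKrullDim (R ⧸ qR) := localDepth_le_ringKrullDim_quotient hqR
      _ ≤ (s.image (algebraMap A R)).card := ringKrullDim_quotient_le_card _ hmax
      _ ≤ s.card := by exact_mod_cast Finset.card_image_le
  exact_mod_cast h

end CohenMacaulay

section CoordinateSubspaces

open MvPolynomial

variable {σ R : Type*} [CommRing R]

lemma ker_eq_span_X_image {A : Type*} [CommRing A] [Algebra R A] {s : Set σ}
    (φ : MvPolynomial σ R →ₐ[R] A) (ψ : A →ₐ[R] MvPolynomial σ R) (hφ : ∀ i ∈ s, φ (X i) = 0)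
    (hψ : ∀ i ∉ s, ψ (φ (X i)) = X i) : RingHom.ker φ = Ideal.span (X '' s) := by
  refine le_antisymm (fun f hf => ?_) ?_
  · have hcomp : ((Ideal.Quotient.mkₐ R (Ideal.span (X '' s))).comp ψ).comp φ =
        Ideal.Quotient.mkₐ R (Ideal.span (X '' s)) := by
      ext i
      by_cases hi : i ∈ s
      · simpa [hφ i hi] using
          (Ideal.Quotient.eq_zero_iff_mem.2 (Ideal.subset_span (Set.mem_image_of_mem X hi))).symm
      · simp [hψ i hi]
    rw [← Ideal.Quotient.eq_zero_iff_mem]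
    simpa [RingHom.mem_ker.1 hf] using (DFunLike.congr_fun hcomp f).symm
  · rw [Ideal.span_le]
    rintro _ ⟨i, hi, rfl⟩
    exact hφ i hi

lemma isPrime_span_X_image [IsDomain R] (s : Set σ) :
    (Ideal.span (X '' s : Set (MvPolynomial σ R))).IsPrime := by
  classical
  rw [← ker_eq_span_X_image (aeval fun i => if i ∈ s then 0 else X i) (.id R _)
    (fun i hi => by simp [hi]) fun i hi => by simp [hi]]
  exact RingHom.ker_isPrime _

lemma isMaximal_span_range_X {K : Type*} [Field K] :
    (Ideal.span (Set.range X : Set (MvPolynomial σ K))).IsMaximal := by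
  rw [← Set.image_univ, ← ker_eq_span_X_image (aeval fun _ => (0 : K)) (Algebra.ofId K _)
    (fun i _ => by simp) fun i hi => absurd (Set.mem_univ i) hi]
  exact RingHom.ker_isMaximal_of_surjective _ fun c => ⟨C c, by simp⟩

lemma X_mem_span_X_image [Nontrivial R] {s : Set σ} {i : σ} :
    (X i : MvPolynomial σ R) ∈ Ideal.span (X '' s) ↔ i ∈ s := by
  classical
  simp [mem_ideal_span_X_image, support_X, Finsupp.single_apply]

end CoordinateSubspaces

section EdgeRing

open MvPolynomial

variable {V : Type*} (K : Type*) [Field K] {G : SimpleGraph V}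

/-- The ideal of the edge ring generated by the variables in `C`. For a vertex cover `C` it
defines the coordinate subspace `x_v = 0`, `v ∈ C`, of the zero locus of the edge ideal. -/
noncomputable def vertexIdeal (G : SimpleGraph V) (C : Set V) :
    Ideal (MvPolynomial V K ⧸ edgeIdeal K G) :=
  (Ideal.span (X '' C)).map (Ideal.Quotient.mk _)

lemma vertexIdeal_eq_span (C : Set V) : vertexIdeal K G C =
    Ideal.span ((fun v => Ideal.Quotient.mk (edgeIdeal K G) (X v)) '' C) := by
  rw [vertexIdeal, Ideal.map_span, Set.image_image]

lemma vertexIdeal_union (C D : Set V) :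
    vertexIdeal K G (C ∪ D) = vertexIdeal K G C ⊔ vertexIdeal K G D := by
  simp only [vertexIdeal_eq_span, Set.image_union, Ideal.span_union]

lemma edgeIdeal_le_span_X_image {C : Set V} (hC : G.IsVertexCover C) :
    edgeIdeal K G ≤ Ideal.span (X '' C) := by
  rw [edgeIdeal, Ideal.span_le]
  rintro _ ⟨v, w, hvw, rfl⟩
  rcases hC hvw with hv | hw
  · exact Ideal.mul_mem_right _ _ (Ideal.subset_span ⟨v, hv, rfl⟩)
  · exact Ideal.mul_mem_left _ _ (Ideal.subset_span ⟨w, hw, rfl⟩)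

lemma mk_X_mem_vertexIdeal {C : Set V} (hC : G.IsVertexCover C) {v : V} :
    Ideal.Quotient.mk (edgeIdeal K G) (X v) ∈ vertexIdeal K G C ↔ v ∈ C := by
  rw [vertexIdeal, Ideal.mem_quotient_iff_mem (edgeIdeal_le_span_X_image K hC),
    X_mem_span_X_image]

lemma isPrime_vertexIdeal {C : Set V} (hC : G.IsVertexCover C) :
    (vertexIdeal K G C).IsPrime :=
  have := isPrime_span_X_image (R := K) C
  Ideal.isPrime_map_quotientMk_of_isPrime (edgeIdeal_le_span_X_image K hC)

lemma isMaximal_vertexIdeal_univ : (vertexIdeal K G Set.univ).IsMaximal := by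
  have huniv : G.IsVertexCover Set.univ := fun v _ _ => .inl (Set.mem_univ v)
  have hmax := isMaximal_span_range_X (σ := V) (K := K)
  rw [← Set.image_univ] at hmax
  exact (Ideal.map_eq_top_or_isMaximal_of_surjective _ Ideal.Quotient.mk_surjective
    hmax).resolve_left (isPrime_vertexIdeal K huniv).ne_top

lemma card_le_height_vertexIdeal {D : Set V} (hD : G.IsVertexCover D) {E : Finset V}
    (hDE : Disjoint D E) : (E.card : ℕ∞) ≤ (vertexIdeal K G (D ∪ E)).height := by
  classical
  induction E using Finset.induction_on with
  | empty => simp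
  | insert x E hx ih =>
    rw [Finset.coe_insert, Set.disjoint_insert_right] at hDE
    have hDE' : G.IsVertexCover (D ∪ E) := hD.subset Set.subset_union_left
    have hxDE : G.IsVertexCover (D ∪ insert x E : Set V) := hD.subset Set.subset_union_left
    have := isPrime_vertexIdeal K hDE'
    have := isPrime_vertexIdeal K hxDE
    have hlt : vertexIdeal K G (D ∪ E) < vertexIdeal K G (D ∪ insert x E) := by
      refine SetLike.lt_iff_le_and_exists.2 ⟨?_, Ideal.Quotient.mk _ (X x), ?_, ?_⟩
      · rw [vertexIdeal, vertexIdeal]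
        gcongr
        exact Set.subset_insert _ _
      · exact (mk_X_mem_vertexIdeal K hxDE).2 (.inr (Set.mem_insert _ _))
      · simp [mk_X_mem_vertexIdeal K hDE', hDE.1, hx]
    rw [Finset.card_insert_of_notMem hx, Finset.coe_insert, Nat.cast_succ]
    exact (add_le_add_left (ih hDE.2) 1).trans (Ideal.height_add_one_le_of_lt_of_isPrime hlt)

lemma isVertexCover_setOf_mk_X_mem (q : Ideal (MvPolynomial V K ⧸ edgeIdeal K G)) [q.IsPrime] :
    G.IsVertexCover {v | Ideal.Quotient.mk (edgeIdeal K G) (X v) ∈ q} := by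
  intro v w hvw
  refine Ideal.IsPrime.mem_or_mem ‹_› ?_
  have hmem : X v * X w ∈ edgeIdeal K G := Ideal.subset_span ⟨v, w, hvw, rfl⟩
  rw [← map_mul, Ideal.Quotient.eq_zero_iff_mem.2 hmem]
  exact q.zero_mem

lemma IsMinimalVertexCover.vertexIdeal_mem_minimalPrimes {C : Finset V}
    (hC : IsMinimalVertexCover G C) :
    vertexIdeal K G C ∈ minimalPrimes (MvPolynomial V K ⧸ edgeIdeal K G) := by
  classical
  refine ⟨⟨isPrime_vertexIdeal K hC.1, bot_le⟩, fun q ⟨hq, _⟩ hqC => ?_⟩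
  let D := C.filter fun v => Ideal.Quotient.mk (edgeIdeal K G) (X v) ∈ q
  have hD : G.IsVertexCover (D : Set V) :=
    (isVertexCover_setOf_mk_X_mem K q).subset fun v hv =>
      Finset.mem_filter.2 ⟨(mk_X_mem_vertexIdeal K hC.1).1 (hqC hv), hv⟩
  rw [vertexIdeal_eq_span, Ideal.span_le]
  rintro _ ⟨v, hv, rfl⟩
  exact (Finset.mem_filter.1 (hC.2 hD (Finset.filter_subset _ _) hv)).2

theorem IsCohenMacaulayGraph.isUnmixed [Finite V] (hCM : IsCohenMacaulayGraph K G) :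
    IsUnmixed G := by
  classical
  intro C D hC hD
  have := Fintype.ofFinite V
  have := hCM.noetherian
  have hmax := isMaximal_vertexIdeal_univ K (G := G)
  have hass : IsAssociatedPrime (vertexIdeal K G C) (MvPolynomial V K ⧸ edgeIdeal K G) := by
    apply Module.associatedPrimes.minimalPrimes_annihilator_subset_associatedPrimes
    rw [Module.annihilator_eq_bot.2 inferInstance]
    exact hC.vertexIdeal_mem_minimalPrimes K
  let s := Cᶜ.image fun v => Ideal.Quotient.mk (edgeIdeal K G) (X v)
  have hsup : vertexIdeal K G Set.univ = vertexIdeal K G C ⊔ Ideal.span s := by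
    rw [Finset.coe_image, ← vertexIdeal_eq_span, ← vertexIdeal_union, Finset.coe_compl,
      Set.union_compl_self]
  have hheight : (Dᶜ.card : ℕ∞) ≤ (vertexIdeal K G Set.univ).height := by
    simpa using card_le_height_vertexIdeal K hD (E := Dᶜ) (by simp [disjoint_compl_right])
  have hle : Dᶜ.card ≤ Cᶜ.card := by
    exact_mod_cast (hheight.trans (hCM.height_le_card hass s hsup)).trans
      (Nat.cast_le.2 Finset.card_image_le)
  rw [Finset.card_compl, Finset.card_compl] at hle
  have := Finset.card_le_univ C
  have := Finset.card_le_univ D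
  omega

end EdgeRing

end CoverIdeal

theorem mainTheorem5_general (K : Type*) [Field K] {V : Type*} [Finite V] (G : SimpleGraph V)
    (him : CoverIdeal.inducedMatchingNumber G = CoverIdeal.matchingNumber G)
    (hG : CoverIdeal.IsUnmixed G) (k : ℕ) :
    CoverIdeal.HasLinearResolution (CoverIdeal.coverIdeal K G ^ k) := by
  obtain ⟨M, hM⟩ := CoverIdeal.exists_isInducedMaximumMatching him
  obtain ⟨r, hr⟩ := hG.exists_isSimplicialPartition (hM.exists_isSimplicial hG)
  exact hr.hasLinearResolution_coverIdeal_pow K k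

theorem mainTheorem5 (K : Type*) [Field K] {V : Type*} [Fintype V] (G : SimpleGraph V)
    (hCW : CoverIdeal.IsCameronWalker G) (hCM : CoverIdeal.IsCohenMacaulayGraph K G) (k : ℕ) :
    CoverIdeal.HasLinearResolution (CoverIdeal.coverIdeal K G ^ k) :=
  mainTheorem5_general K G hCW.inducedMatchingNumber_eq (hCM.isUnmixed K) k
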